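/- Let $k$ be an algebraically closed field, let $1\le a\le n-1$ be integers with $\gcd(a,n)=1$, and assume that $n$ is invertible in $k$. Let $\zeta\in k$ be a primitive $n$-th root of unity, let the cyclic group $G=\frac1n(1,a)$ generated by $\mathrm{diag}(\zeta,\zeta^a)$ act on $S=k[[x,y]]$ by $x\mapsto \zeta x$, $y\mapsto\zeta^a y$, and let $R=S^G$, a local ring with maximal ideal $\mathfrak m$. For $0\le t\le n-1$ let $M_t\subset S$ be the $R$-submodule generated by the monomials $x^iy^j$ with $i+ja\equiv t\pmod n$, and let $\mu_R(M_t)=\dim_{R/\mathfrak m}M_t/\mathfrak mM_t$ be its minimal number of generators. Let $$\frac na=\alpha_1-\cfrac1{\alpha_2-\cfrac1{\cdots-\frac1{\alpha_r}}}\qquad(r\ge 1,\ \alpha_1,\dots,\alpha_r\ge 2\text{ integers})$$ be the Hirzebruch–Jung continued fraction expansion, and let the $i$-series be given by $i_0=n$, $i_1=a$, $i_s=\alpha_{s-1}i_{s-1}-i_{s-2}$ for $s\geq 2$. For $0\le t\le n-1$ put $h_0=t$ and, for $u=1,\dots,r$, let $d_u$ and $h_u$ be the quotient and the remainder in the division of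 $h_{u-1}$ by $i_u$, so $h_{u-1}=d_ui_u+h_u$ with $0\le h_u<i_u$. Then $t=d_1i_1+d_2i_2+\cdots+d_ri_r$ and $$\mu_R(M_t)=d_1+d_2+\cdots+d_r+1.$$ -/

import Mathlib

open MvPowerSeries

noncomputable section

namespace CyclicQuotient

/-! ### The invariant ring of the cyclic group of type `(1/n)(1,a)` -/

section Ring

variable (k : Type*) [Field k]

/-- The power series ring `S = k[[x, y]]`, with `x = X 0` and `y = X 1`. -/
abbrev PS : Type _ := MvPowerSeries (Fin 2) k

variable {k}

/-- The automorphism of `k[[x, y]]` given by the diagonal matrix `diag(ζ, ζ ^ a)`,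
that is `f(x, y) ↦ f(ζ x, ζ ^ a y)`. -/
def sigma (ζ : kˣ) (a : ℕ) : PS k ≃ₐ[k] PS k :=
  AlgEquiv.ofAlgHom
    (rescaleAlgHom ![(ζ : k), (ζ : k) ^ a])
    (rescaleAlgHom ![((ζ⁻¹ : kˣ) : k), ((ζ⁻¹ : kˣ) : k) ^ a])
    (by
      rw [← rescaleAlgHom_mul]
      convert rescaleAlgHom_one using 2
      ext i
      fin_cases i <;> simp)
    (by
      rw [← rescaleAlgHom_mul]
      convert rescaleAlgHom_one using 2
      ext i
      fin_cases i <;> simp)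

/-- The cyclic group `G = ⟨diag(ζ, ζ ^ a)⟩`, as a group of automorphisms of `k[[x, y]]`.
For `ζ` a primitive `n`-th root of unity it is the group `(1/n)(1,a)`. -/
def cyclicGroup (ζ : kˣ) (a : ℕ) : Subgroup (PS k ≃ₐ[k] PS k) :=
  Subgroup.zpowers (sigma ζ a)

/-- The invariant ring `R = S^G`. -/
abbrev invRing (ζ : kˣ) (a : ℕ) : Subalgebra k (PS k) :=
  FixedPoints.subalgebra k (PS k) (cyclicGroup ζ a)

/-- The `R`-module `M_t`: the `R`-submodule of `S` generated by all monomials `x ^ i * y ^ j`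
with `i + j a ≡ t (mod n)`. -/
def cmModule (n a : ℕ) (ζ : kˣ) (t : ℕ) : Submodule (invRing ζ a) (PS k) :=
  Submodule.span (invRing ζ a)
    {f | ∃ i j : ℕ, i + j * a ≡ t [MOD n] ∧ f = (X 0 : PS k) ^ i * (X 1 : PS k) ^ j}

/-- `R` is a local ring. -/
instance invRing_isLocalRing (ζ : kˣ) (a : ℕ) : IsLocalRing (invRing ζ a) := by
  have : IsLocalHom (invRing ζ a).val.toRingHom := by
    refine ⟨fun f hf => ?_⟩
    obtain ⟨u, hu⟩ := hf
    have hu' : (u : PS k) = f := hu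
    have key : ∀ g : cyclicGroup ζ a, g • ((u⁻¹ : (PS k)ˣ) : PS k) = ((u⁻¹ : (PS k)ˣ) : PS k) := by
      intro g
      have h1 : g • (u : PS k) = u := by rw [hu']; exact f.2 g
      have h2 : g • ((u : PS k) * ((u⁻¹ : (PS k)ˣ) : PS k)) = 1 := by simp
      rw [smul_mul', h1] at h2
      exact (Units.inv_eq_of_mul_eq_one_right h2).symm
    refine IsUnit.of_mul_eq_one ⟨((u⁻¹ : (PS k)ˣ) : PS k), key⟩ ?_
    apply Subtype.ext
    change (f : PS k) * ((u⁻¹ : (PS k)ˣ) : PS k) = 1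
    rw [← hu']
    simp
  exact RingHom.domain_isLocalRing (invRing ζ a).val.toRingHom

theorem coeff_sigma (ζ : kˣ) (a : ℕ) (f : PS k) (m : Fin 2 →₀ ℕ) :
    coeff m (sigma ζ a f) = (ζ : k) ^ (m 0 + m 1 * a) * coeff m f := by
  have : sigma ζ a f = rescale ![(ζ : k), (ζ : k) ^ a] f := by
    rw [← rescaleAlgHom_apply]; rfl
  rw [this]
  rw [coeff_rescale, Finsupp.prod_fintype _ _ (by simp)]
  simp [Fin.prod_univ_two, pow_add, ← pow_mul, mul_comm a]

theorem mem_invRing_iff (ζ : kˣ) (a : ℕ) (f : PS k) :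
    f ∈ invRing ζ a ↔ sigma ζ a f = f := by
  constructor
  · intro h
    exact h ⟨sigma ζ a, Subgroup.mem_zpowers _⟩
  · rintro h ⟨g, hg⟩
    have : cyclicGroup ζ a ≤ MulAction.stabilizer (PS k ≃ₐ[k] PS k) f := by
      rw [cyclicGroup, Subgroup.zpowers_le]; exact h
    exact this hg

/-- `M_t` is also the module `(S ⊗ V_t)^G` of semi-invariants, where `V_t` is the character
of `G` that sends the generator to `ζ ^ (-t)`. -/
theorem mem_cmModule_iff {n : ℕ} (hn : n ≠ 0) (a : ℕ) {ζ : kˣ} (hζ : IsPrimitiveRoot (ζ : k) n)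
    (t : ℕ) (f : PS k) :
    f ∈ cmModule n a ζ t ↔ sigma ζ a f = (ζ : k) ^ t • f := by
  have hpow : ∀ b c : ℕ, (ζ : k) ^ b = (ζ : k) ^ c ↔ b ≡ c [MOD n] := by
    intro b c
    have := hζ.eq_orderOf
    rw [← Units.val_pow_eq_pow_val, ← Units.val_pow_eq_pow_val, Units.val_inj, pow_eq_pow_iff_modEq,
      ← orderOf_units, ← this]
  have hne : ∀ b, (ζ : k) ^ b ≠ 0 := fun b => pow_ne_zero _ ζ.ne_zero
  constructor
  · intro hf
    induction hf using Submodule.span_induction with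
    | mem f h =>
      obtain ⟨i, j, hij, rfl⟩ := h
      have hX (s : Fin 2) : sigma ζ a (X s : PS k) = (![(ζ : k), (ζ : k) ^ a] s) • (X s : PS k) := by
        ext m
        rw [coeff_sigma, coeff_smul, coeff_X]
        fin_cases s <;> by_cases h : m = Finsupp.single 0 1 <;>
          by_cases h' : m = Finsupp.single 1 1 <;> simp [h, h', Finsupp.single_left_inj]
      rw [map_mul, map_pow, map_pow, hX, hX, ← (hpow _ _).2 hij]
      simp only [smul_pow, Matrix.cons_val_zero, Matrix.cons_val_one, smul_mul_smul_comm,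
        pow_add, ← pow_mul, mul_comm a]
    | zero => simp
    | add f g _ _ hf hg => rw [map_add, hf, hg, smul_add]
    | smul r f _ hf =>
      have : sigma ζ a (r : PS k) = r := (mem_invRing_iff ζ a r).1 r.2
      change sigma ζ a ((r : PS k) * f) = (ζ : k) ^ t • ((r : PS k) * f)
      rw [map_mul, this, hf, mul_smul_comm]
  · intro hf
    have hsupp : ∀ m : Fin 2 →₀ ℕ, coeff m f ≠ 0 → m 0 + m 1 * a ≡ t [MOD n] := by
      intro m hm
      have := congrArg (coeff m) hf
      rw [coeff_sigma, coeff_smul] at this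
      exact (hpow _ _).1 (mul_right_cancel₀ hm this)
    let e : ℕ → ℕ → (Fin 2 →₀ ℕ) := fun p q => Finsupp.single 0 p + Finsupp.single 1 q
    have hmon : ∀ p q, (X 0 : PS k) ^ p * (X 1 : PS k) ^ q = monomial (e p q) 1 := by
      intro p q
      rw [X_pow_eq, X_pow_eq, monomial_mul_monomial, one_mul]
    let g : ℕ → ℕ → PS k := fun p q m =>
      if n ∣ m 0 ∧ n ∣ m 1 ∧ (p + q * a ≡ t [MOD n]) then coeff (m + e p q) f else 0
    have hgc : ∀ p q m, coeff m (g p q) =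
      if n ∣ m 0 ∧ n ∣ m 1 ∧ (p + q * a ≡ t [MOD n]) then coeff (m + e p q) f else 0 :=
      fun p q m => rfl
    have hg : ∀ p q, g p q ∈ invRing ζ a := by
      intro p q
      rw [mem_invRing_iff]
      ext m
      rw [coeff_sigma, hgc]
      split_ifs with h
      · have h1 : (ζ : k) ^ (m 0 + m 1 * a) = (ζ : k) ^ 0 := by
          rw [hpow]
          exact (Nat.modEq_zero_iff_dvd.2 (dvd_add h.1 (h.2.1.mul_right a)))
        rw [h1, pow_zero, one_mul]
      · simp
    have hsum : f = ∑ p ∈ Finset.range n, ∑ q ∈ Finset.range n,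
        g p q * ((X 0 : PS k) ^ p * (X 1 : PS k) ^ q) := by
      ext m
      simp only [map_sum, hmon, coeff_mul_monomial, mul_one]
      have hterm : ∀ p ∈ Finset.range n, ∀ q ∈ Finset.range n,
          (if e p q ≤ m then coeff (m - e p q) (g p q) else 0) =
            if p = m 0 % n then (if q = m 1 % n then coeff m f else 0) else 0 := by
        intro p hp q hq
        rw [Finset.mem_range] at hp hq
        have hle : e p q ≤ m ↔ p ≤ m 0 ∧ q ≤ m 1 := by
          simp [e, Finsupp.le_def]
        by_cases hl : e p q ≤ m
        · rw [if_pos hl, hgc, tsub_add_cancel_of_le hl]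
          obtain ⟨h0, h1⟩ := hle.1 hl
          have d0 : n ∣ (m - e p q) 0 ↔ p = m 0 % n := by
            simp only [e, Finsupp.tsub_apply, Finsupp.add_apply, Finsupp.single_apply]
            simp only [if_true, one_ne_zero, if_false, add_zero]
            rw [← Nat.modEq_iff_dvd' h0, Nat.ModEq, Nat.mod_eq_of_lt hp]
          have d1 : n ∣ (m - e p q) 1 ↔ q = m 1 % n := by
            simp only [e, Finsupp.tsub_apply, Finsupp.add_apply, Finsupp.single_apply]
            simp only [if_true, zero_ne_one, if_false, zero_add]
            rw [← Nat.modEq_iff_dvd' h1, Nat.ModEq, Nat.mod_eq_of_lt hq]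
          simp only [d0, d1]
          by_cases hp' : p = m 0 % n
          · by_cases hq' : q = m 1 % n
            · by_cases hz : coeff m f = 0
              · simp [hz]
              · have := hsupp m hz
                have h3 : p + q * a ≡ t [MOD n] := by
                  refine Nat.ModEq.trans ?_ this
                  rw [hp', hq']
                  exact (Nat.mod_modEq _ _).add ((Nat.mod_modEq _ _).mul_right a)
                simp [← hp', ← hq', h3]
            · simp [hq']
          · simp [hp']
        · rw [if_neg hl]
          split_ifs with hp' hq'
          · exact absurd (hle.2 ⟨hp' ▸ Nat.mod_le _ _, hq' ▸ Nat.mod_le _ _⟩) hl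
          · rfl
          · rfl
      rw [Finset.sum_congr rfl fun p hp => Finset.sum_congr rfl fun q hq => hterm p hp q hq]
      have hn' := Nat.pos_of_ne_zero hn
      simp [Nat.mod_lt _ hn', Finset.sum_ite_eq']
    rw [hsum]
    refine Submodule.sum_mem _ fun p _ => Submodule.sum_mem _ fun q _ => ?_
    by_cases h : p + q * a ≡ t [MOD n]
    · exact Submodule.smul_mem _ (⟨g p q, hg p q⟩ : invRing ζ a)
        (Submodule.subset_span ⟨p, q, h, rfl⟩)
    · have : g p q = 0 := by
        ext m; rw [hgc]; simp [h]
      rw [this, zero_mul]; exact Submodule.zero_mem _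

end Ring

/-- `μ_R(M) = dim (M / 𝔪 M)` over the residue field `R / 𝔪`, the number of minimal generators
of a finitely generated module `M` over a local ring `(R, 𝔪)`. -/
def mu (R : Type*) [CommRing R] [IsLocalRing R] (M : Type*) [AddCommGroup M] [Module R M] : ℕ :=
  Module.finrank (R ⧸ IsLocalRing.maximalIdeal R)
    (M ⧸ (IsLocalRing.maximalIdeal R • ⊤ : Submodule R M))

/-! ### Continued fractions, the `i`-series and the greedy expansion -/

/-- `hjFrac α s l` is the value
`[α_s, α_{s+1}, …, α_{s+l}] = α_s - 1 / (α_{s+1} - 1 / (⋯ - 1 / α_{s+l}))`. -/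
def hjFrac (α : ℕ → ℤ) : ℕ → ℕ → ℚ
  | s, 0 => α s
  | s, l + 1 => α s - 1 / hjFrac α (s + 1) l

/-- `q = [α_1, …, α_r]` is the Hirzebruch-Jung continued fraction expansion of `q`:
`r ≥ 1` and all the entries `α_1, …, α_r` are at least `2`.
(Only the values of `α` at `1, …, r` matter.) -/
structure IsHJExpansion (q : ℚ) (r : ℕ) (α : ℕ → ℤ) : Prop where
  one_le : 1 ≤ r
  two_le : ∀ s, 1 ≤ s → s ≤ r → 2 ≤ α s
  eq : q = hjFrac α 1 (r - 1)

/-- The `i`-series: `i_0 = n`, `i_1 = a`, `i_t = α_{t-1} i_{t-1} - i_{t-2}`. -/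
def iSeries (n a : ℕ) (α : ℕ → ℤ) : ℕ → ℤ
  | 0 => n
  | 1 => a
  | t + 2 => α (t + 1) * iSeries n a α (t + 1) - iSeries n a α t

/-- The remainders of the greedy expansion of `t` in a sequence `i_1, i_2, …`:
`h_0 = t`, and `h_{u+1}` is the remainder of `h_u` on division by `i_{u+1}`. -/
def greedyRem (i : ℕ → ℤ) (t : ℕ) : ℕ → ℤ
  | 0 => t
  | u + 1 => greedyRem i t u % i (u + 1)

/-- The digits of the greedy expansion of `t` in a sequence `i_1, i_2, …`:
for `u ≥ 1`, `d_u` is the quotient of `h_{u-1}` on division by `i_u`. -/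
def greedyDigit (i : ℕ → ℤ) (t : ℕ) (u : ℕ) : ℤ :=
  greedyRem i t (u - 1) / i u

end CyclicQuotient

end

/-! `M_t` consists of the power series supported on exponents `(i, j)` with `i + ja ≡ t (mod n)`.
Its divisibility-minimal monomials give a basis of `M_t / 𝔪 M_t`: they generate, and at a minimal
exponent an invariant acts on the coefficient through its constant term only. Hence `μ` counts
minimal lattice points (`mu_cmModule_eq_ncard`).

The count is a Euclidean descent (`encard_minimalPoints`). The minimal points with `i ≥ a` are the
`d_1` points `(t - ja, j)`, `0 ≤ j < d_1`. If `i < a`, write `i + ja = t + kn`. Modulo `a` this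
reads `i - kn ≡ t`, so `(i, k)` is a point of the same problem for `(a, α_1 a - n, t mod a) = (i_1,
i_2, h_1)`, and `(i, j) ↦ (i, k)` matches minimal points. Step `u` thus contributes `d_u`. Since
`gcd(a, n) = 1`, the series ends with `i_r = 1`, `i_{r+1} = 0` (`iSeries_last`). This forces `h_r =
0`, which gives the expansion of `t`, and leaves the problem `(1, 0, 0)`, whose only minimal point
is the origin: the final `+ 1`. -/

namespace CyclicQuotient

/-! ### Minimal lattice points and their recursion -/

/-- The points `(x, j)` of the nonnegative quadrant with `x + j a ≡ t (mod n)`. -/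
def residuePoints (n a t : ℤ) : Set (ℤ × ℤ) :=
  {p | 0 ≤ p.1 ∧ 0 ≤ p.2 ∧ n ∣ p.1 + p.2 * a - t}

/-- The minimal elements of `residuePoints n a t` for the componentwise order. -/
def minimalPoints (n a t : ℤ) : Set (ℤ × ℤ) :=
  {p | Minimal (· ∈ residuePoints n a t) p}

theorem mem_minimalPoints {n a t : ℤ} {x j : ℤ} :
    (x, j) ∈ minimalPoints n a t ↔ (0 ≤ x ∧ 0 ≤ j ∧ n ∣ x + j * a - t) ∧
      ∀ y i : ℤ, 0 ≤ y → 0 ≤ i → n ∣ y + i * a - t → y ≤ x → i ≤ j → x ≤ y ∧ j ≤ i := by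
  constructor
  · rintro ⟨h, h'⟩
    exact ⟨h, fun y i h1 h2 h3 h4 h5 =>
      h' (y := (y, i)) ⟨h1, h2, h3⟩ (Prod.mk_le_mk.2 ⟨h4, h5⟩)⟩
  · rintro ⟨h, h'⟩
    refine ⟨h, ?_⟩
    rintro ⟨y, i⟩ ⟨h1, h2, h3⟩ h4
    exact Prod.mk_le_mk.2 (h' y i h1 h2 h3 h4.1 h4.2)

theorem eq_of_dvd_sub_of_lt {n u v : ℤ} (h : n ∣ u - v) (hu : 0 ≤ u) (hun : u < n)
    (hv : 0 ≤ v) (hvn : v < n) : u = v := by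
  have := Int.eq_zero_of_abs_lt_dvd h (by rw [abs_lt]; constructor <;> linarith)
  linarith

/-- Comparison with the points `(t % a, t / a)` and `(t, 0)` forces `j < t / a` and `x ≤ t`. -/
theorem mem_minimalPoints_of_le {n a t : ℤ} (ha : 0 < a) (ht0 : 0 ≤ t) (ht : t < n)
    {x j : ℤ} (hx : a ≤ x) :
    (x, j) ∈ minimalPoints n a t ↔ 0 ≤ j ∧ j < t / a ∧ x = t - j * a := by
  have hd := Int.mul_ediv_add_emod t a
  have h0 := Int.emod_nonneg t ha.ne'
  have h1 := Int.emod_lt_of_pos t ha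
  have hq : 0 ≤ t / a := Int.ediv_nonneg ht0 ha.le
  rw [mem_minimalPoints]
  constructor
  · rintro ⟨⟨hx0, hj, hdvd⟩, hmin⟩
    have hjd : j < t / a := by
      by_contra hcon
      have := hmin (t % a) (t / a) h0 hq ⟨0, by linarith⟩ (by linarith) (by linarith)
      linarith
    refine ⟨hj, hjd, ?_⟩
    have hxt : x ≤ t := by
      by_contra hcon
      have := hmin t 0 ht0 le_rfl ⟨0, by ring⟩ (by linarith) hj
      linarith
    have hja : j * a ≤ t := by nlinarith
    have : 0 ≤ j * a := by positivity
    -- Both `x` and `t - j a` lie in `[0, n)`, so congruence means equality.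
    exact eq_of_dvd_sub_of_lt (n := n) (by convert hdvd using 1; ring) hx0 (by linarith)
      (by linarith) (by linarith)
  · rintro ⟨hj, hjd, rfl⟩
    have hja : 0 ≤ j * a := by positivity
    refine ⟨⟨by linarith, hj, ⟨0, by ring⟩⟩, fun y i hy hi hdvd hyx hij => ?_⟩
    have hia : i * a ≤ j * a := by nlinarith
    have hia0 : 0 ≤ i * a := by positivity
    have : y = t - i * a := eq_of_dvd_sub_of_lt (n := n) (by convert hdvd using 1; ring) hy
      (by linarith) (by linarith) (by linarith)
    have : j * a ≤ i * a := by linarith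
    exact ⟨by linarith, le_of_mul_le_mul_right this ha⟩

/-- A point `(x, j)` of `residuePoints n a t` gives a point `(x, k)` of
`residuePoints a (c a - n) (t % a)`, where `k` is determined by `x + j a = t + k n`. -/
theorem exists_mem_residuePoints_ediv {n a t c x j : ℤ} (ha : 0 < a) (ht0 : 0 ≤ t) (ht : t < n)
    (hx : 0 ≤ x) :
    (0 ≤ j ∧ n ∣ x + j * a - t) →
      ∃ k, 0 ≤ k ∧ x + j * a = t + k * n ∧ a ∣ x + k * (c * a - n) - t % a := by
  rintro ⟨hj, k, hk⟩
  refine ⟨k, ?_, by linarith, ⟨t / a + k * c - j, ?_⟩⟩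
  -- A negative `k` would give `t + k n < 0`, whereas `x + j a ≥ 0`.
  · by_contra hcon
    have : 0 ≤ j * a := by positivity
    nlinarith
  · have hd := Int.mul_ediv_add_emod t a
    linear_combination hk - hd

/-- A point `(x, k)` of `residuePoints a (c a - n) (t % a)` with `x < a` comes from a point `(x, j)`
of `residuePoints n a t`, where `x + j a = t + k n`. -/
theorem exists_of_mem_residuePoints {n a t c x k : ℤ} (ha : 0 < a) (han : a ≤ n) (ht0 : 0 ≤ t)
    (hx : 0 ≤ x) (hxa : x < a) :
    (0 ≤ k ∧ a ∣ x + k * (c * a - n) - t % a) →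
      ∃ j, 0 ≤ j ∧ x + j * a = t + k * n ∧ n ∣ x + j * a - t := by
  rintro ⟨hk, m, hm⟩
  have hd := Int.mul_ediv_add_emod t a
  have h0 := Int.emod_nonneg t ha.ne'
  have h1 := Int.emod_lt_of_pos t ha
  have hj : x + (k * c - m + t / a) * a = t + k * n := by linear_combination hd + hm
  refine ⟨k * c - m + t / a, ?_, hj, ⟨k, by linarith⟩⟩
  -- For `k = 0` the point is `x = t % a`, `j = t / a`; for `k ≥ 1`, `j a = t + k n - x` is positive
  -- because `x < a ≤ n`.
  rcases hk.eq_or_lt with rfl | hk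
  · have : x = t % a := eq_of_dvd_sub_of_lt (n := a) ⟨m, by linarith⟩ hx hxa h0 h1
    have : 0 ≤ t / a := Int.ediv_nonneg ht0 ha.le
    have : a * m = 0 := by linarith
    have : m = 0 := by simpa [ha.ne'] using this
    subst this
    linarith
  · by_contra hcon
    have : (k * c - m + t / a) * a ≤ 0 := by nlinarith
    nlinarith

/-- The integer `c` is arbitrary because only `c a - n` modulo `a` matters; the continued fraction
later supplies `c = α_{s+1}`. -/
theorem minimalPoints_eq_union {n a t : ℤ} (c : ℤ) (ha : 0 < a) (han : a ≤ n) (ht0 : 0 ≤ t)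
    (ht : t < n) :
    minimalPoints n a t = (fun j => (t - j * a, j)) '' Set.Ico 0 (t / a) ∪
      (fun p => (p.1, (t + p.2 * n - p.1) / a)) '' minimalPoints a (c * a - n) (t % a) := by
  have hdm := Int.mul_ediv_add_emod t a
  have h0 := Int.emod_nonneg t ha.ne'
  have h1 := Int.emod_lt_of_pos t ha
  have hlt : ∀ {x k : ℤ}, (x, k) ∈ minimalPoints a (c * a - n) (t % a) → x < a := by
    intro x k h
    rw [mem_minimalPoints] at h
    by_contra hcon
    have := h.2 (t % a) 0 h0 le_rfl ⟨0, by ring⟩ (by linarith) h.1.2.1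
    linarith
  -- In the strip `0 ≤ x < a` two first coordinates differ by less than `a ≤ n`, too little to
  -- offset a unit change of `k` or `j`. So `j` and `k` order the points compatibly, and minimality
  -- transfers both ways.
  have hmono : ∀ {x y i j k l : ℤ}, 0 ≤ x → x < a → 0 ≤ y → y < a → x + j * a = t + k * n →
      y + i * a = t + l * n → i ≤ j → l ≤ k := by
    intro x y i j k l hx hxa hy hya e1 e2 hij
    by_contra hcon
    have : (k + 1) * n ≤ l * n := by nlinarith
    nlinarith
  have hmono' : ∀ {x y i j k l : ℤ}, 0 ≤ x → x < a → 0 ≤ y → y < a → x + j * a = t + k * n →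
      y + i * a = t + l * n → y ≤ x → l ≤ k → i ≤ j := by
    intro x y i j k l hx hxa hy hya e1 e2 hyx hlk
    by_contra hcon
    have h2 : (j + 1) * a ≤ i * a := by nlinarith
    have h3 : l * n ≤ k * n := by nlinarith
    nlinarith
  ext ⟨x, j⟩
  rcases le_or_gt a x with hx | hxa
  · rw [mem_minimalPoints_of_le ha ht0 ht hx]
    simp only [Set.mem_union, Set.mem_image, Set.mem_Ico, Prod.mk.injEq, Prod.exists]
    constructor
    · rintro ⟨h2, h3, rfl⟩
      exact Or.inl ⟨j, ⟨h2, h3⟩, rfl, rfl⟩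
    · rintro (⟨j, ⟨h2, h3⟩, rfl, rfl⟩ | ⟨y, k, h, rfl, -⟩)
      · exact ⟨h2, h3, rfl⟩
      · exact absurd (hlt h) (not_lt.2 hx)
  · simp only [Set.mem_union, Set.mem_image, Set.mem_Ico, Prod.mk.injEq, Prod.exists]
    constructor
    · intro h
      right
      rw [mem_minimalPoints] at h
      obtain ⟨⟨hx, hj, hdvd⟩, hmin⟩ := h
      obtain ⟨k, hk, e, hdvd'⟩ := exists_mem_residuePoints_ediv (c := c) ha ht0 ht hx ⟨hj, hdvd⟩
      refine ⟨x, k, ?_, rfl, ?_⟩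
      · rw [mem_minimalPoints]
        refine ⟨⟨hx, hk, hdvd'⟩, fun y l hy hl hd hyx hlk => ?_⟩
        obtain ⟨i, hi, e', hd'⟩ :=
          exists_of_mem_residuePoints ha han ht0 hy (hyx.trans_lt hxa) ⟨hl, hd⟩
        have hij := hmono' hx hxa hy (hyx.trans_lt hxa) e e' hyx hlk
        obtain ⟨h2, h3⟩ := hmin y i hy hi hd' hyx hij
        exact ⟨h2, hmono hy (hyx.trans_lt hxa) hx hxa e' e h3⟩
      · rw [← e, add_sub_cancel_left, Int.mul_ediv_cancel _ ha.ne']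
    · rintro (⟨i, ⟨hi, hid⟩, rfl, rfl⟩ | ⟨y, k, h, rfl, rfl⟩)
      · nlinarith
      · rw [mem_minimalPoints] at h
        obtain ⟨⟨hx, hk, hdvd⟩, hmin⟩ := h
        obtain ⟨j, hj, e, hdvd'⟩ := exists_of_mem_residuePoints ha han ht0 hx hxa ⟨hk, hdvd⟩
        rw [← e, add_sub_cancel_left, Int.mul_ediv_cancel _ ha.ne', mem_minimalPoints]
        refine ⟨⟨hx, hj, hdvd'⟩, fun z i hz hi hd hzy hij => ?_⟩
        obtain ⟨l, hl, e', hd'⟩ :=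
          exists_mem_residuePoints_ediv (c := c) ha ht0 ht hz ⟨hi, hd⟩
        have hlk := hmono hx hxa hz (hzy.trans_lt hxa) e e' hij
        obtain ⟨h2, h3⟩ := hmin z l hz hl hd' hzy hlk
        exact ⟨h2, hmono' hz (hzy.trans_lt hxa) hx hxa e' e h2 h3⟩

theorem encard_minimalPoints {n a t : ℤ} (c : ℤ) (ha : 0 < a) (han : a ≤ n) (ht0 : 0 ≤ t)
    (ht : t < n) :
    (minimalPoints n a t).encard =
      ((t / a).toNat : ℕ∞) + (minimalPoints a (c * a - n) (t % a)).encard := by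
  have h0 := Int.emod_nonneg t ha.ne'
  have hdm := Int.mul_ediv_add_emod t a
  rw [minimalPoints_eq_union c ha han ht0 ht, Set.encard_union_eq]
  · congr 1
    · rw [Function.Injective.encard_image fun i j h => (Prod.mk.inj h).2, ← Finset.coe_Ico,
        Set.encard_coe_eq_coe_finsetCard, Int.card_Ico, sub_zero]
    · refine Set.InjOn.encard_image ?_
      rintro ⟨x, k⟩ hp ⟨y, l⟩ hq h
      rw [mem_minimalPoints] at hp hq
      simp only [Prod.mk.injEq] at h ⊢
      obtain ⟨rfl, h⟩ := h
      refine ⟨rfl, ?_⟩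
      -- The division by `a` is exact at these points, so equal quotients give equal `k`.
      have hdvd : ∀ k, a ∣ x + k * (c * a - n) - t % a → a ∣ t + k * n - x := by
        rintro k ⟨m, hm⟩
        exact ⟨t / a + k * c - m, by linear_combination -hm - hdm⟩
      have := (Int.ediv_left_inj (hdvd k hp.1.2.2) (hdvd l hq.1.2.2)).1 h
      have : k * n = l * n := by linarith
      exact mul_right_cancel₀ (by linarith) this
  · rw [Set.disjoint_left]
    rintro _ ⟨j, ⟨hj, hjd⟩, rfl⟩ ⟨⟨x, k⟩, hp, h⟩
    rw [mem_minimalPoints] at hp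
    simp only [Prod.mk.injEq] at h
    -- A common point would have `x = t - j a ≥ a`, but minimality against `(t % a, 0)` bounds `x`
    -- by `t % a < a`.
    have := hp.2 (t % a) 0 h0 le_rfl ⟨0, by ring⟩ (by nlinarith) hp.1.2.1
    have := Int.emod_lt_of_pos t ha
    nlinarith

theorem minimalPoints_one_zero : minimalPoints 1 0 0 = {(0, 0)} := by
  ext ⟨x, j⟩
  rw [mem_minimalPoints, Set.mem_singleton_iff, Prod.mk.injEq]
  constructor
  · rintro ⟨⟨hx, hj, -⟩, h⟩
    have := h 0 0 le_rfl le_rfl (by simp) hx hj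
    omega
  · rintro ⟨rfl, rfl⟩
    simp +contextual

/-! ### Continued fraction, `i`-series and greedy digits -/

theorem one_lt_hjFrac (α : ℕ → ℤ) (l s : ℕ) (h : ∀ u, s ≤ u → u ≤ s + l → 2 ≤ α u) :
    1 < hjFrac α s l := by
  induction l generalizing s with
  | zero =>
    have := h s le_rfl le_rfl
    rw [hjFrac]
    exact_mod_cast (by linarith : (1 : ℤ) < α s)
  | succ l ih =>
    have h1 := ih (s + 1) fun u hu hu' => h u (by omega) (by omega)
    have h2 : (2 : ℚ) ≤ α s := by exact_mod_cast h s le_rfl (by omega)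
    rw [hjFrac]
    have : 1 / hjFrac α (s + 1) l < 1 := by
      rw [div_lt_one (by linarith)]; exact h1
    linarith

section ISeries

variable {n a r : ℕ} {α : ℕ → ℤ}

/-- The ratios of consecutive terms are the tails of the continued fraction. These exceed 1, so the
series stays positive and decreases. -/
theorem iSeries_invariant (ha : 1 ≤ a) (hcop : Nat.gcd a n = 1)
    (hα : IsHJExpansion ((n : ℚ) / (a : ℚ)) r α) (s : ℕ) (hs : s < r) :
    0 < iSeries n a α (s + 1) ∧ iSeries n a α (s + 1) < iSeries n a α s ∧
      IsCoprime (iSeries n a α s) (iSeries n a α (s + 1)) ∧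
      (iSeries n a α s : ℚ) / iSeries n a α (s + 1) = hjFrac α (s + 1) (r - 1 - s) := by
  suffices h : 0 < iSeries n a α (s + 1) ∧
      IsCoprime (iSeries n a α s) (iSeries n a α (s + 1)) ∧
      (iSeries n a α s : ℚ) / iSeries n a α (s + 1) = hjFrac α (s + 1) (r - 1 - s) by
    obtain ⟨h1, h2, h3⟩ := h
    refine ⟨h1, ?_, h2, h3⟩
    have h4 := one_lt_hjFrac α (r - 1 - s) (s + 1)
      fun u hu hu' => hα.two_le u (by omega) (by omega)
    rw [← h3, one_lt_div (by exact_mod_cast h1)] at h4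
    exact_mod_cast h4
  induction s with
  | zero =>
    refine ⟨by simpa [iSeries, Nat.pos_iff_ne_zero] using Nat.one_le_iff_ne_zero.1 ha, ?_, by simpa [iSeries] using hα.eq⟩
    exact (Nat.isCoprime_iff_coprime.2 hcop).symm
  | succ s ih =>
    obtain ⟨h1, h2, h3⟩ := ih (by omega)
    have hF := one_lt_hjFrac α (r - 1 - (s + 1)) (s + 2)
      fun u hu hu' => hα.two_le u (by omega) (by omega)
    have hr : r - 1 - s = (r - 1 - (s + 1)) + 1 := by omega
    rw [hr, hjFrac] at h3
    have h1' : (0 : ℚ) < iSeries n a α (s + 1) := by exact_mod_cast h1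
    have hi : iSeries n a α (s + 2) = α (s + 1) * iSeries n a α (s + 1) - iSeries n a α s := rfl
    -- With `F` the next tail, `i_s = (α_{s+1} - 1/F) i_{s+1}`, so the recursion gives `i_{s+2} =
    -- i_{s+1} / F`.
    have hi' : (iSeries n a α (s + 2) : ℚ) =
        iSeries n a α (s + 1) / hjFrac α (s + 2) (r - 1 - (s + 1)) := by
      rw [hi]
      push_cast
      rw [div_eq_iff h1'.ne'] at h3
      rw [h3]
      ring
    have hpos : (0 : ℚ) < iSeries n a α (s + 2) := by
      rw [hi']; exact div_pos h1' (by linarith)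
    refine ⟨by exact_mod_cast hpos, ?_, ?_⟩
    · rw [show s + 1 + 1 = s + 2 from rfl, hi]
      obtain ⟨u, v, huv⟩ := h2
      exact ⟨v + u * α (s + 1), -u, by linear_combination huv⟩
    · rw [show s + 1 + 1 = s + 2 from rfl, hi']
      field_simp

/-- The last tail is the integer `α_r`, so `i_r` divides `i_{r-1}`; being coprime to it and
positive, `i_r` is 1. -/
theorem iSeries_last (ha : 1 ≤ a) (hcop : Nat.gcd a n = 1)
    (hα : IsHJExpansion ((n : ℚ) / (a : ℚ)) r α) :
    iSeries n a α r = 1 ∧ iSeries n a α (r + 1) = 0 := by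
  obtain ⟨s, rfl⟩ : ∃ s, r = s + 1 := ⟨r - 1, by have := hα.one_le; omega⟩
  obtain ⟨h1, -, h2, h3⟩ := iSeries_invariant ha hcop hα s (by omega)
  rw [show s + 1 - 1 - s = 0 by omega, hjFrac, div_eq_iff (by exact_mod_cast h1.ne')] at h3
  have h4 : iSeries n a α s = α (s + 1) * iSeries n a α (s + 1) := by exact_mod_cast h3
  refine ⟨?_, ?_⟩
  · have := h2.isUnit_of_dvd' ⟨α (s + 1), by rw [h4, mul_comm]⟩ dvd_rfl
    rcases Int.isUnit_iff.1 this with h | h <;> omega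
  · change α (s + 1) * iSeries n a α (s + 1) - iSeries n a α s = 0
    rw [h4, sub_self]

theorem greedyRem_bounds (ha : 1 ≤ a) (hcop : Nat.gcd a n = 1)
    (hα : IsHJExpansion ((n : ℚ) / (a : ℚ)) r α) {t : ℕ} (ht : t < n) (s : ℕ) (hs : s ≤ r) :
    0 ≤ greedyRem (iSeries n a α) t s ∧
      greedyRem (iSeries n a α) t s < iSeries n a α s := by
  cases s with
  | zero => simpa [greedyRem, iSeries] using ht
  | succ s =>
    have h := (iSeries_invariant ha hcop hα s hs).1
    exact ⟨Int.emod_nonneg _ h.ne', Int.emod_lt_of_pos _ h⟩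

theorem eq_sum_greedyDigit_add_greedyRem (i : ℕ → ℤ) (t s : ℕ) :
    (t : ℤ) = ∑ u ∈ Finset.Icc 1 s, greedyDigit i t u * i u + greedyRem i t s := by
  induction s with
  | zero => simp [greedyRem]
  | succ s ih =>
    rw [Finset.sum_Icc_succ_top (by omega), greedyDigit, Nat.add_sub_cancel, greedyRem]
    have := Int.mul_ediv_add_emod (greedyRem i t s) (i (s + 1))
    linear_combination ih - this

theorem encard_minimalPoints_eq_sum_add (ha : 1 ≤ a) (hcop : Nat.gcd a n = 1)
    (hα : IsHJExpansion ((n : ℚ) / (a : ℚ)) r α) {t : ℕ} (ht : t < n) (s : ℕ) (hs : s ≤ r) :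
    (minimalPoints n a t).encard =
      ((∑ u ∈ Finset.Icc 1 s, greedyDigit (iSeries n a α) t u).toNat : ℕ∞) +
      (minimalPoints (iSeries n a α s) (iSeries n a α (s + 1))
        (greedyRem (iSeries n a α) t s)).encard := by
  induction s with
  | zero => simp [iSeries, greedyRem]
  | succ s ih =>
    obtain ⟨h1, h2, -⟩ := iSeries_invariant ha hcop hα s hs
    obtain ⟨h3, h4⟩ := greedyRem_bounds ha hcop hα ht s (by omega)
    have hnn : ∀ u ∈ Finset.Icc 1 s, 0 ≤ greedyDigit (iSeries n a α) t u := by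
      intro u hu
      rw [Finset.mem_Icc] at hu
      obtain ⟨v, rfl⟩ : ∃ v, u = v + 1 := ⟨u - 1, by omega⟩
      exact Int.ediv_nonneg (greedyRem_bounds ha hcop hα ht v (by omega)).1
        (iSeries_invariant ha hcop hα v (by omega)).1.le
    rw [ih (by omega), encard_minimalPoints (α (s + 1)) h1 h2.le h3 h4,
      Finset.sum_Icc_succ_top (by omega), Int.toNat_add (Finset.sum_nonneg hnn)
        (b := greedyDigit (iSeries n a α) t (s + 1)) (Int.ediv_nonneg h3 h1.le),
      Nat.cast_add, ← add_assoc]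
    rfl

theorem ncard_minimalPoints (ha : 1 ≤ a) (hcop : Nat.gcd a n = 1)
    (hα : IsHJExpansion ((n : ℚ) / (a : ℚ)) r α) {t : ℕ} (ht : t < n) :
    (minimalPoints n a t).Finite ∧ ((minimalPoints n a t).ncard : ℤ) =
      ∑ u ∈ Finset.Icc 1 r, greedyDigit (iSeries n a α) t u + 1 := by
  have h := encard_minimalPoints_eq_sum_add ha hcop hα ht r le_rfl
  obtain ⟨h1, h2⟩ := iSeries_last ha hcop hα
  obtain ⟨h3, h4⟩ := greedyRem_bounds ha hcop hα ht r le_rfl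
  have h5 : greedyRem (iSeries n a α) t r = 0 := by omega
  rw [h1, h2, h5, minimalPoints_one_zero, Set.encard_singleton] at h
  have hfin : (minimalPoints n a t).Finite := by
    rw [← Set.encard_lt_top_iff, h]
    exact_mod_cast ENat.natCast_lt_top _
  refine ⟨hfin, ?_⟩
  rw [← hfin.cast_ncard_eq] at h
  have h' : (minimalPoints n a t).ncard =
      (∑ u ∈ Finset.Icc 1 r, greedyDigit (iSeries n a α) t u).toNat + 1 := by exact_mod_cast h
  rw [h', Nat.cast_add, Nat.cast_one, Int.toNat_of_nonneg]
  refine Finset.sum_nonneg fun u hu => ?_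
  rw [Finset.mem_Icc] at hu
  obtain ⟨v, rfl⟩ : ∃ v, u = v + 1 := ⟨u - 1, by omega⟩
  exact Int.ediv_nonneg (greedyRem_bounds ha hcop hα ht v (by omega)).1
    (iSeries_invariant ha hcop hα v (by omega)).1.le

end ISeries


/-! ### Minimal generators of `M_t` and minimal monomials -/

section Generators

/-- A finite generating family of `M` whose relations modulo `𝔪 M` all have coefficients in `𝔪`
has `μ_R(M)` elements. -/
theorem mu_eq_card_of_span_of_independent {R M ι : Type*} [CommRing R] [IsLocalRing R]
    [AddCommGroup M] [Module R M] [Fintype ι] (e : ι → M)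
    (hspan : ∀ f, ∃ g : ι → R, f = ∑ w, g w • e w)
    (hind : ∀ g : ι → R, ∑ w, g w • e w ∈ (IsLocalRing.maximalIdeal R • ⊤ : Submodule R M) →
      ∀ w, g w ∈ IsLocalRing.maximalIdeal R) :
    mu R M = Fintype.card ι := by
  let I := IsLocalRing.maximalIdeal R
  let v : ι → M ⧸ (I • ⊤ : Submodule R M) := fun w => Submodule.Quotient.mk (e w)
  have hmk : ∀ g : ι → R, (I • ⊤ : Submodule R M).mkQ (∑ w, g w • e w) =
      ∑ w, Ideal.Quotient.mk I (g w) • v w := fun g => map_sum _ _ _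
  have hli : LinearIndependent (R ⧸ I) v := by
    rw [Fintype.linearIndependent_iff]
    intro c hc w
    choose g hg using fun w => Ideal.Quotient.mk_surjective (c w)
    rw [← hg w, Ideal.Quotient.eq_zero_iff_mem]
    refine hind g ?_ w
    rw [← Submodule.Quotient.mk_eq_zero, ← Submodule.mkQ_apply, hmk, ← hc]
    exact Finset.sum_congr rfl fun w _ => by rw [hg w]
  have hsp : ⊤ ≤ Submodule.span (R ⧸ I) (Set.range v) := by
    rintro x -
    obtain ⟨f, rfl⟩ := Submodule.Quotient.mk_surjective _ x
    obtain ⟨g, rfl⟩ := hspan f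
    rw [← Submodule.mkQ_apply, hmk]
    exact Submodule.sum_mem _ fun w _ =>
      Submodule.smul_mem _ _ (Submodule.subset_span ⟨w, rfl⟩)
  rw [mu, Module.finrank_eq_card_basis (Module.Basis.mk hli hsp)]

variable {k : Type*} [Field k]

/-- The exponents of the monomials `x ^ i * y ^ j` with `i + j a ≡ t (mod n)`. -/
def classExponents (n a t : ℕ) : Set (Fin 2 →₀ ℕ) :=
  {m | m 0 + m 1 * a ≡ t [MOD n]}

/-- The minimal elements of `classExponents n a t` for divisibility of monomials. -/
def minimalExponents (n a t : ℕ) : Set (Fin 2 →₀ ℕ) :=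
  {m | Minimal (· ∈ classExponents n a t) m}

theorem mem_classExponents_iff_of_add {n a t : ℕ} {m w : Fin 2 →₀ ℕ}
    (hw : w ∈ classExponents n a t) :
    m + w ∈ classExponents n a t ↔ m ∈ classExponents n a 0 := by
  have hw' : w 0 + w 1 * a ≡ t [MOD n] := hw
  change (m + w) 0 + (m + w) 1 * a ≡ t [MOD n] ↔ m 0 + m 1 * a ≡ 0 [MOD n]
  have h : (m + w) 0 + (m + w) 1 * a = (m 0 + m 1 * a) + (w 0 + w 1 * a) := by
    simp only [Finsupp.add_apply]; ring
  rw [h]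
  constructor
  · intro h'
    refine Nat.ModEq.add_right_cancel' (w 0 + w 1 * a) ?_
    rw [zero_add]
    exact h'.trans hw'.symm
  · intro h'
    simpa using h'.add hw'

theorem minimalExponents_image (n a t : ℕ) :
    (fun m : Fin 2 →₀ ℕ => ((m 0 : ℤ), (m 1 : ℤ))) '' minimalExponents n a t =
      minimalPoints n a t := by
  have hiff : ∀ m : Fin 2 →₀ ℕ, m ∈ classExponents n a t ↔ (n : ℤ) ∣ m 0 + m 1 * a - t := by
    intro m
    change m 0 + m 1 * a ≡ t [MOD n] ↔ _
    rw [Nat.ModEq.comm, Nat.modEq_iff_dvd]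
    push_cast
    rfl
  have hle : ∀ m w : Fin 2 →₀ ℕ, m ≤ w ↔ m 0 ≤ w 0 ∧ m 1 ≤ w 1 := by
    intro m w
    rw [Finsupp.le_def, Fin.forall_fin_two]
  ext ⟨x, j⟩
  simp only [Set.mem_image, Prod.mk.injEq]
  rw [mem_minimalPoints]
  constructor
  · rintro ⟨m, hm, rfl, rfl⟩
    refine ⟨⟨by positivity, by positivity, (hiff m).1 hm.1⟩, fun y i hy hi hd h1 h2 => ?_⟩
    lift y to ℕ using hy
    lift i to ℕ using hi
    have := hm.2 (y := Finsupp.single 0 y + Finsupp.single 1 i) ((hiff _).2 (by simpa using hd))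
      ((hle _ _).2 (by simpa using And.intro h1 h2))
    rw [hle] at this
    simpa using this
  · rintro ⟨⟨hx, hj, hd⟩, hmin⟩
    lift x to ℕ using hx
    lift j to ℕ using hj
    refine ⟨Finsupp.single 0 x + Finsupp.single 1 j, ⟨(hiff _).2 (by simpa using hd), ?_⟩,
      by simp, by simp⟩
    intro m hm hmle
    rw [hle] at hmle ⊢
    have := hmin (m 0) (m 1) (by positivity) (by positivity) ((hiff m).1 hm)
      (by simpa using hmle.1) (by simpa using hmle.2)
    simpa using this

theorem injective_exponents :
    Function.Injective (fun m : Fin 2 →₀ ℕ => ((m 0 : ℤ), (m 1 : ℤ))) := by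
  intro m w h
  simp only [Prod.mk.injEq, Nat.cast_inj] at h
  ext i
  fin_cases i
  · exact h.1
  · exact h.2

variable {n a : ℕ} {ζ : kˣ} {t : ℕ}

theorem pow_eq_pow_iff_modEq_of_isPrimitiveRoot (hζ : IsPrimitiveRoot (ζ : k) n) (b c : ℕ) :
    (ζ : k) ^ b = (ζ : k) ^ c ↔ b ≡ c [MOD n] := by
  rw [← Units.val_pow_eq_pow_val, ← Units.val_pow_eq_pow_val, Units.val_inj,
    pow_eq_pow_iff_modEq, ← orderOf_units, ← hζ.eq_orderOf]

/-- A power series is a `ζ ^ t`-eigenvector of `sigma ζ a` if and only if its support lies in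
`classExponents n a t`. -/
theorem sigma_eq_smul_iff (hζ : IsPrimitiveRoot (ζ : k) n) (f : PS k) :
    sigma ζ a f = (ζ : k) ^ t • f ↔ ∀ m, coeff m f ≠ 0 → m ∈ classExponents n a t := by
  constructor
  · intro h m hm
    have := congrArg (coeff m) h
    rw [coeff_sigma, coeff_smul] at this
    exact (pow_eq_pow_iff_modEq_of_isPrimitiveRoot hζ _ _).1 (mul_right_cancel₀ hm this)
  · intro h
    ext m
    rw [coeff_sigma, coeff_smul]
    by_cases hm : coeff m f = 0
    · simp [hm]
    · rw [(pow_eq_pow_iff_modEq_of_isPrimitiveRoot hζ _ _).2 (h m hm)]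

theorem mem_invRing_iff_support (hζ : IsPrimitiveRoot (ζ : k) n) (f : PS k) :
    f ∈ invRing ζ a ↔ ∀ m, coeff m f ≠ 0 → m ∈ classExponents n a 0 := by
  rw [mem_invRing_iff, ← sigma_eq_smul_iff hζ, pow_zero, one_smul]

theorem mem_cmModule_iff_support (hn : n ≠ 0) (hζ : IsPrimitiveRoot (ζ : k) n) (f : PS k) :
    f ∈ cmModule n a ζ t ↔ ∀ m, coeff m f ≠ 0 → m ∈ classExponents n a t := by
  rw [mem_cmModule_iff hn a hζ, sigma_eq_smul_iff hζ]

/-- At a minimal exponent, multiplication by an invariant scales the coefficient by the constant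
term. -/
theorem coeff_mul_of_mem_minimalExponents {w : Fin 2 →₀ ℕ} (hw : w ∈ minimalExponents n a t)
    (g f : PS k) (hf : ∀ m, coeff m f ≠ 0 → m ∈ classExponents n a t) :
    coeff w (g * f) = constantCoeff g * coeff w f := by
  rw [coeff_mul, Finset.sum_eq_single (0, w)]
  · simp
  · rintro ⟨p, q⟩ hpq hne
    rw [Finset.HasAntidiagonal.mem_antidiagonal] at hpq
    by_cases hq : coeff q f = 0
    -- Any `q` in the support of `f` with `q ≤ w` equals `w` by minimality, so only `p = 0`
    -- contributes.
    · simp [hq]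
    · have hle : q ≤ w := by rw [← hpq]; exact le_add_self
      have : q = w := le_antisymm hle (hw.2 (hf q hq) hle)
      subst this
      exact absurd (by simpa using hpq) (fun h : p = 0 => hne (by rw [h]))
  · intro h
    simp at h

theorem mem_maximalIdeal_iff (r : invRing ζ a) :
    r ∈ IsLocalRing.maximalIdeal (invRing ζ a) ↔ constantCoeff (r : PS k) = 0 := by
  rw [IsLocalRing.mem_maximalIdeal, mem_nonunits_iff, not_iff_comm]
  constructor
  · intro h
    obtain ⟨u, hu⟩ := MvPowerSeries.isUnit_iff_constantCoeff.2 (isUnit_iff_ne_zero.2 h)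
    have hinv : ((u⁻¹ : (PS k)ˣ) : PS k) ∈ invRing ζ a := by
      have hr := (mem_invRing_iff ζ a _).1 r.2
      rw [mem_invRing_iff]
      have h2 : sigma ζ a ((u : PS k) * ((u⁻¹ : (PS k)ˣ) : PS k)) = 1 := by simp
      rw [map_mul, hu, hr, ← hu] at h2
      exact (Units.inv_eq_of_mul_eq_one_right h2).symm
    refine IsUnit.of_mul_eq_one ⟨((u⁻¹ : (PS k)ˣ) : PS k), hinv⟩ (Subtype.ext ?_)
    change (r : PS k) * ((u⁻¹ : (PS k)ˣ) : PS k) = 1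
    rw [← hu, Units.mul_inv]
  · intro h
    have := (h.map (invRing ζ a).val).map (constantCoeff (σ := Fin 2) (R := k))
    exact this.ne_zero

/-- A power series supported in `classExponents n a t` is a combination of the monomials with
minimal exponent, with coefficients in the invariant ring. -/
theorem exists_eq_sum_mul_monomial (hζ : IsPrimitiveRoot (ζ : k) n)
    [Fintype (minimalExponents n a t)] (f : PS k)
    (hf : ∀ m, coeff m f ≠ 0 → m ∈ classExponents n a t) :
    ∃ g : minimalExponents n a t → invRing ζ a,
      f = ∑ w, (g w : PS k) * monomial (w : Fin 2 →₀ ℕ) (1 : k) := by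
  classical
  have hex : ∀ m : Fin 2 →₀ ℕ, m ∈ classExponents n a t →
      ∃ w : minimalExponents n a t, (w : Fin 2 →₀ ℕ) ≤ m := by
    intro m hm
    obtain ⟨w, hw, hw'⟩ := exists_minimal_le_of_wellFoundedLT (· ∈ classExponents n a t) m hm
    exact ⟨⟨w, hw'⟩, hw⟩
  choose φ hφ using hex
  -- `φ` assigns each exponent in the class one minimal exponent below it; `g w` is the part of `f`
  -- assigned to `w`, divided by that monomial.
  let g : minimalExponents n a t → PS k := fun w m =>
    if h : m + (w : Fin 2 →₀ ℕ) ∈ classExponents n a t then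
      if φ (m + (w : Fin 2 →₀ ℕ)) h = w then coeff (m + (w : Fin 2 →₀ ℕ)) f else 0
    else 0
  have hgc : ∀ w m, coeff m (g w) =
    if h : m + (w : Fin 2 →₀ ℕ) ∈ classExponents n a t then
      if φ (m + (w : Fin 2 →₀ ℕ)) h = w then coeff (m + (w : Fin 2 →₀ ℕ)) f else 0
    else 0 := fun w m => rfl
  refine ⟨fun w => ⟨g w, (mem_invRing_iff_support hζ _).2 fun m hm => ?_⟩, ?_⟩
  · by_contra hcon
    rw [← mem_classExponents_iff_of_add w.2.1] at hcon
    rw [hgc, dif_neg hcon] at hm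
    exact hm rfl
  · ext m
    simp only [map_sum, coeff_mul_monomial, mul_one]
    by_cases hm : m ∈ classExponents n a t
    · rw [Finset.sum_eq_single (φ m hm)]
      · rw [if_pos (hφ m hm), hgc]
        simp only [tsub_add_cancel_of_le (hφ m hm), hm, dif_pos, if_true]
      · intro w _ hne
        split_ifs with hle
        · rw [hgc]
          simp only [tsub_add_cancel_of_le hle, hm, dif_pos, if_neg hne.symm]
        · rfl
      · simp
    · have h0 : coeff m f = 0 := by
        by_contra h
        exact hm (hf m h)
      rw [h0, Finset.sum_eq_zero]
      intro w _
      split_ifs with hle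
      · rw [hgc]
        simp only [tsub_add_cancel_of_le hle, hm, dif_neg, not_false_iff]
      · rfl

theorem monomial_mem_cmModule (hn : n ≠ 0) (hζ : IsPrimitiveRoot (ζ : k) n)
    (w : minimalExponents n a t) :
    (monomial (w : Fin 2 →₀ ℕ) (1 : k) : PS k) ∈ cmModule n a ζ t := by
  classical
  rw [mem_cmModule_iff_support hn hζ]
  intro m hm
  rw [coeff_monomial] at hm
  split_ifs at hm with h
  · exact h ▸ w.2.1
  · exact absurd rfl hm

/-- `μ_R(M_t)` is the number of minimal monomials in `M_t`. -/
theorem mu_cmModule_eq_ncard (hn : n ≠ 0) (hζ : IsPrimitiveRoot (ζ : k) n)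
    (hfin : (minimalExponents n a t).Finite) :
    mu (invRing ζ a) (cmModule n a ζ t) = (minimalExponents n a t).ncard := by
  classical
  have := hfin.fintype
  let e : minimalExponents n a t → cmModule n a ζ t :=
    fun w => ⟨_, monomial_mem_cmModule hn hζ w⟩
  have hsum : ∀ g : minimalExponents n a t → invRing ζ a,
      ((∑ w, g w • e w : cmModule n a ζ t) : PS k) =
        ∑ w, (g w : PS k) * monomial (w : Fin 2 →₀ ℕ) (1 : k) := by
    intro g
    rw [AddSubmonoidClass.coe_finsetSum]
    rfl
  rw [mu_eq_card_of_span_of_independent e, ← Nat.card_coe_set_eq, Nat.card_eq_fintype_card]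
  · intro f
    obtain ⟨g, hg⟩ := exists_eq_sum_mul_monomial hζ (f : PS k)
      ((mem_cmModule_iff_support hn hζ _).1 f.2)
    exact ⟨g, Subtype.ext (by rw [hsum]; exact hg)⟩
  · intro g h1 w
    -- The coefficient at a minimal exponent `w` vanishes on `𝔪 M_t`; on the relation it reads off
    -- the constant term of `g w`.
    have h2 : coeff (w : Fin 2 →₀ ℕ) ((∑ w, g w • e w : cmModule n a ζ t) : PS k) = 0 := by
      generalize (∑ w, g w • e w : cmModule n a ζ t) = f at h1
      induction h1 using Submodule.smul_induction_on' with
      | smul r hr f _ =>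
        change coeff (w : Fin 2 →₀ ℕ) ((r : PS k) * (f : PS k)) = 0
        rw [coeff_mul_of_mem_minimalExponents w.2 _ _
          ((mem_cmModule_iff_support hn hζ _).1 f.2), (mem_maximalIdeal_iff r).1 hr, zero_mul]
      | add f _ g _ hf hg =>
        rw [Submodule.coe_add, map_add, hf, hg, add_zero]
    rw [hsum, map_sum, Finset.sum_eq_single w] at h2
    · rw [coeff_mul_of_mem_minimalExponents w.2 _ _
        ((mem_cmModule_iff_support hn hζ _).1 (monomial_mem_cmModule hn hζ w)),
        coeff_monomial_same, mul_one] at h2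
      exact (mem_maximalIdeal_iff _).2 h2
    · intro w' _ hne
      rw [coeff_mul_of_mem_minimalExponents w.2 _ _
        ((mem_cmModule_iff_support hn hζ _).1 (monomial_mem_cmModule hn hζ w')),
        coeff_monomial_ne (fun h => hne (Subtype.ext h.symm)), mul_zero]
    · simp

end Generators

end CyclicQuotient

/-! ### The main theorem -/

theorem theorem3p2 {k : Type*} [Field k] [IsAlgClosed k] (n a : ℕ)
    (ha : 1 ≤ a) (han : a < n) (hcop : Nat.gcd a n = 1) (hnk : (n : k) ≠ 0)
    (ζ : kˣ) (hζ : IsPrimitiveRoot (ζ : k) n)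
    (r : ℕ) (α : ℕ → ℤ) (hα : CyclicQuotient.IsHJExpansion ((n : ℚ) / (a : ℚ)) r α)
    (t : ℕ) (ht : t < n) :
    (t : ℤ) = ∑ u ∈ Finset.Icc 1 r,
        CyclicQuotient.greedyDigit (CyclicQuotient.iSeries n a α) t u *
          CyclicQuotient.iSeries n a α u ∧
    (CyclicQuotient.mu (CyclicQuotient.invRing ζ a) (CyclicQuotient.cmModule n a ζ t) : ℤ) =
      (∑ u ∈ Finset.Icc 1 r,
        CyclicQuotient.greedyDigit (CyclicQuotient.iSeries n a α) t u) + 1 := by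
  open CyclicQuotient in
  constructor
  · have h1 := (iSeries_last ha hcop hα).1
    have h2 := greedyRem_bounds ha hcop hα ht r le_rfl
    have h3 := eq_sum_greedyDigit_add_greedyRem (iSeries n a α) t r
    have h4 : greedyRem (iSeries n a α) t r = 0 := by omega
    rwa [h4, add_zero] at h3
  · obtain ⟨hfin, hcard⟩ := ncard_minimalPoints ha hcop hα ht
    rw [← minimalExponents_image] at hfin hcard
    rw [Set.ncard_image_of_injective _ injective_exponents] at hcard
    rw [mu_cmModule_eq_ncard (by omega) hζ (hfin.of_finite_image injective_exponents.injOn), hcard]
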